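/- **Proposition 4.3 (Boundedness).** There is a function $C=C(m,N,t)\in[0,\infty)$ of $m\ge 0$, $N\in\mathbb N$, $t\in[1,\infty]$, nondecreasing in $m$, such that the following holds. Let $N\ge 1$ and let $\Omega\subset\mathbb R^N$ be a bounded open set (no regularity of the boundary is assumed), with Lebesgue measure $|\Omega|$. Let $A\in L^\infty(\Omega)^{N\times N}$ satisfy $A(x)\xi\cdot\xi\ge\alpha|\xi|^2$ for a.e. $x\in\Omega$ and all $\xi\in\mathbb R^N$, with some $\alpha>0$. Let $F:\Omega\times[0,\infty[\to[0,\infty]$ be a Carathéodory function ($F(x,\cdot)$ is continuous for a.e. $x\in\Omega$, and $F(\cdot,s)$ is measurable for every $s\ge 0$) such that $$0\le F(x,s)\le h(x)\Big(\frac1{s^\gamma}+1\Big)\quad\text{for a.e. }x\in\Omega,\ \forall s>0,$$ where $0<\gamma\le 1$, $h\ge 0$ a.e. in $\Omega$, and $h\in L^r(\Omega)$ with $r=\frac{2N}{N+2}$ if $N\ge 3$, some $r>1$ if $N=2$, and $r=1$ if $N=1$. Assume moreover that $h\in L^t(\Omega)$, where $t>N/2$ if $N\ge 2$, and $t=1$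 if $N=1$. Let $u$ be any solution of $-\mathrm{div}\,A(x)Du=F(x,u)$ in $\Omega$, $u=0$ on $\partial\Omega$, in the following sense: $u\in H^1_0(\Omega)$, $u\ge 0$ a.e. in $\Omega$, and for every $\varphi\in H^1_0(\Omega)$ with $\varphi\ge 0$, $$\int_\Omega F(x,u)\,\varphi<+\infty\quad\text{and}\quad\int_\Omega A(x)Du\cdot D\varphi=\int_\Omega F(x,u)\,\varphi$$ (with the convention $\infty\cdot 0=0$ in the product $F(x,u)\varphi$). Then $u\in L^\infty(\Omega)$ and $$\|u\|_{L^\infty(\Omega)}\le 1+\frac2\alpha\,C(|\Omega|,N,t)\,\|h\|_{L^t(\Omega)}.$$ -/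

import Mathlib

open MeasureTheory Filter Topology TopologicalSpace
open scoped NNReal ENNReal Distributions Gradient

/-- `ℝ^N` with its Euclidean norm and Lebesgue measure `volume`. -/
abbrev RN (N : ℕ) : Type := EuclideanSpace ℝ (Fin N)

/-- `g` is the weak (distributional) gradient of `u` in the open set `Ω`:
`∫_Ω u ∇φ = - ∫_Ω φ g` for all `φ ∈ 𝓓(Ω)` (smooth with compact support in `Ω`). -/
def HasWeakGradient {N : ℕ} (Ω : Opens (RN N)) (u : RN N → ℝ) (g : RN N → RN N) : Prop :=
  LocallyIntegrableOn u Ω ∧ LocallyIntegrableOn g Ω ∧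
    ∀ φ : 𝓓(Ω, ℝ), ∫ x in (Ω : Set (RN N)), u x • ∇ (φ : RN N → ℝ) x
      = - ∫ x in (Ω : Set (RN N)), φ x • g x

/-- `u ∈ H¹(Ω)`, with weak gradient `Du`. -/
structure MemH1 {N : ℕ} (Ω : Opens (RN N)) (u : RN N → ℝ) (Du : RN N → RN N) : Prop where
  memLp : MemLp u 2 (volume.restrict Ω)
  memLp_grad : MemLp Du 2 (volume.restrict Ω)
  hasWeakGradient : HasWeakGradient Ω u Du

/-- `u ∈ H¹₀(Ω)`, with weak gradient `Du`: `u` belongs to the closure of `𝓓(Ω)` for the norm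
of `H¹(Ω)`. -/
structure MemH10 {N : ℕ} (Ω : Opens (RN N)) (u : RN N → ℝ) (Du : RN N → RN N) : Prop
    extends MemH1 Ω u Du where
  approx : ∃ φ : ℕ → 𝓓(Ω, ℝ),
    Tendsto (fun n => eLpNorm (fun x => u x - φ n x) 2 (volume.restrict Ω)) atTop (𝓝 0) ∧
    Tendsto (fun n => eLpNorm (fun x => Du x - ∇ (φ n : RN N → ℝ) x) 2 (volume.restrict Ω))
      atTop (𝓝 0)

/-- `A ∈ L^∞(Ω)^{N×N}` and `A(x) ≥ α I` for almost every `x ∈ Ω`, with `α > 0`. -/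
structure CoerciveMatrix {N : ℕ} (Ω : Opens (RN N)) (A : RN N → Matrix (Fin N) (Fin N) ℝ)
    (α : ℝ) : Prop where
  memLp_top : ∀ i j, MemLp (fun x => A x i j) ∞ (volume.restrict Ω)
  pos : 0 < α
  coercive : ∀ᵐ x ∂(volume.restrict (Ω : Set (RN N))), ∀ ξ : RN N,
    α * ‖ξ‖ ^ 2 ≤ inner ℝ ((A x).toEuclideanLin ξ) ξ

/-- `F : Ω × [0,∞[ → [0,∞]` is a Carathéodory function. Measurability in `x` is meant in the
sense of Lebesgue, that is, up to a null set. -/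
structure IsCaratheodory {N : ℕ} (Ω : Opens (RN N)) (F : RN N → ℝ≥0 → ℝ≥0∞) : Prop where
  continuous : ∀ᵐ x ∂(volume.restrict (Ω : Set (RN N))), Continuous (F x)
  measurable : ∀ s : ℝ≥0, AEMeasurable (fun x => F x s) (volume.restrict Ω)

/-- The growth condition with the mild singularity: `0 < γ ≤ 1`, `h ≥ 0` belongs to `L^r(Ω)` with
`r = 2N/(N+2)` if `N ≥ 3`, some `r > 1` if `N = 2`, `r = 1` if `N = 1`, and
`F(x,s) ≤ h(x) (1/s^γ + 1)` for a.e. `x ∈ Ω` and all `s > 0`. -/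
structure GrowthCondition {N : ℕ} (Ω : Opens (RN N)) (F : RN N → ℝ≥0 → ℝ≥0∞) (γ : ℝ)
    (h : RN N → ℝ) : Prop where
  gamma_pos : 0 < γ
  gamma_le_one : γ ≤ 1
  memLp_one : N = 1 → MemLp h 1 (volume.restrict Ω)
  memLp_two : N = 2 → ∃ r : ℝ≥0∞, 1 < r ∧ MemLp h r (volume.restrict Ω)
  memLp_three : 3 ≤ N → MemLp h (2 * N / (N + 2)) (volume.restrict Ω)
  nonneg : ∀ᵐ x ∂(volume.restrict (Ω : Set (RN N))), 0 ≤ h x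
  bound : ∀ᵐ x ∂(volume.restrict (Ω : Set (RN N))), ∀ s : ℝ≥0, 0 < s →
    F x s ≤ ENNReal.ofReal (h x * (1 / (s : ℝ) ^ γ + 1))

/-- `u` is a solution to `- div A(x) Du = F(x,u)` in `Ω`, `u = 0` on `∂Ω`: `u ∈ H¹₀(Ω)`, `u ≥ 0`
a.e. in `Ω`, and for all `φ ∈ H¹₀(Ω)`, `φ ≥ 0`, one has `∫_Ω F(x,u) φ < ∞` and
`∫_Ω A(x) Du · Dφ = ∫_Ω F(x,u) φ`. The integral of `F(x,u) φ` is that of a `[0,∞]`-valued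
function, with the convention `∞ · 0 = 0`. -/
def IsSolution {N : ℕ} (Ω : Opens (RN N)) (A : RN N → Matrix (Fin N) (Fin N) ℝ)
    (F : RN N → ℝ≥0 → ℝ≥0∞) (u : RN N → ℝ) : Prop :=
  ∃ Du : RN N → RN N, MemH10 Ω u Du ∧
    (∀ᵐ x ∂(volume.restrict (Ω : Set (RN N))), 0 ≤ u x) ∧
    ∀ (φ : RN N → ℝ) (Dφ : RN N → RN N), MemH10 Ω φ Dφ →
      (∀ᵐ x ∂(volume.restrict (Ω : Set (RN N))), 0 ≤ φ x) →
      (∫⁻ x in (Ω : Set (RN N)), F x (u x).toNNReal * ENNReal.ofReal (φ x)) < ∞ ∧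
      ∫ x in (Ω : Set (RN N)), inner ℝ ((A x).toEuclideanLin (Du x)) (Dφ x)
        = (∫⁻ x in (Ω : Set (RN N)), F x (u x).toNNReal * ENNReal.ofReal (φ x)).toReal

/-! This is Stampacchia's method, run at levels k ≥ 1, where the singular factor 1/s^γ + 1 is at
most 2. Testing the equation with a smooth truncation v of u above k gives α‖Dv‖₂² ≤ 2‖h‖_τ ‖v‖_q
with τ, q conjugate (`energy_smoothTrunc`). Let q be the Sobolev exponent of some p ≤ 2. Since Dv
lives on {u > k}, Hölder trades ‖Dv‖_p for ‖Dv‖₂ times a power of |{u > k}|. Absorbing one factor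
‖Dv‖₂ and applying Hölder and Markov to v gives d |{u > k + d}| ≤ M |{u > k}|^(1+δ)
(`IsSolution.measureReal_superlevel_le`). Here δ = 2/N - 1/τ, which is positive because τ > N/2
(`exists_exponents`). Superlinear decay forces the superlevel sets to become null at a finite level
(`eq_zero_of_superlevel_decay`).

The truncation is smooth, so only the chain rule for smooth functions is needed in H¹₀
(`MemH10.comp`); the price is the constant `smoothRamp 1`. All Sobolev estimates are for test
functions and pass to H¹₀ by density, so the boundary plays no role. -/

/-! ### Sobolev inequalities for compactly supported functions. -/

theorem norm_gradient_eq_norm_fderiv {N : ℕ} (f : RN N → ℝ) (x : RN N) :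
    ‖∇ f x‖ = ‖fderiv ℝ f x‖ := by
  simp [gradient]

/-- After an isometric identification with ℝ, compact support makes u(x) the integral of its
derivative over a half-line. This is the endpoint p = 1, q = ∞. -/
theorem enorm_le_lintegral_enorm_fderiv_of_one {u : RN 1 → ℝ} (hu : ContDiff ℝ 1 u)
    (h2u : HasCompactSupport u) (x : RN 1) : ‖u x‖ₑ ≤ ∫⁻ y, ‖fderiv ℝ u y‖ₑ := by
  let e : ℝ ≃ₗᵢ[ℝ] RN 1 := (OrthonormalBasis.singleton (Fin 1) ℝ).repr
  have hmp : MeasurePreserving e := e.measurePreserving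
  have hderiv (s : ℝ) : ‖deriv (u ∘ e) s‖ₑ ≤ ‖fderiv ℝ u (e s)‖ₑ := by
    have h1 : HasDerivAt (u ∘ e) (fderiv ℝ u (e s) (e 1)) s := by
      have h2 := (hu.differentiable one_ne_zero (e s)).hasFDerivAt
      have h3 : HasDerivAt e (e 1) s := by
        simpa using! (e.toContinuousLinearEquiv.toContinuousLinearMap.hasFDerivAt (x := s)).hasDerivAt
      exact h2.comp_hasDerivAt s h3
    rw [h1.deriv, ← ofReal_norm, ← ofReal_norm]
    apply ENNReal.ofReal_le_ofReal
    calc _ ≤ ‖fderiv ℝ u (e s)‖ * ‖e 1‖ := ContinuousLinearMap.le_opNorm _ _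
      _ = _ := by simp
  calc ‖u x‖ₑ = ‖(u ∘ e) (e.symm x)‖ₑ := by simp
    _ ≤ ∫⁻ s in Set.Iic (e.symm x), ‖deriv (u ∘ e) s‖ₑ :=
        HasCompactSupport.enorm_le_lintegral_Ici_deriv
          (hu.comp e.toContinuousLinearEquiv.contDiff)
          (h2u.comp_homeomorph e.toHomeomorph) _
    _ ≤ ∫⁻ s, ‖deriv (u ∘ e) s‖ₑ := setLIntegral_le_lintegral _ _
    _ ≤ ∫⁻ s, ‖fderiv ℝ u (e s)‖ₑ := lintegral_mono hderiv
    _ = _ := hmp.lintegral_comp (f := fun y => ‖fderiv ℝ u y‖ₑ)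
        (hu.continuous_fderiv one_ne_zero).enorm.measurable

/-- The Sobolev inequality `‖φ‖_q ≤ S ‖∇φ‖_p` for `1/q = 1/p - 1/N ≥ 0`, including the case
`N = p = 1`, `q = ∞`. -/
theorem exists_sobolev_const {N : ℕ} {p q : ℝ≥0∞} (hN : 1 ≤ N) (hp : 1 ≤ p) (hpt : p ≠ ∞)
    (hpq : q⁻¹ + (N : ℝ≥0∞)⁻¹ = p⁻¹) (hq : 2 ≤ N → q ≠ ∞) :
    ∃ S : ℝ≥0, ∀ φ : RN N → ℝ, ContDiff ℝ 1 φ → HasCompactSupport φ →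
      eLpNorm φ q volume ≤ S * eLpNorm (∇ φ) p volume := by
  have hgrad (φ : RN N → ℝ) : eLpNorm (∇ φ) p volume = eLpNorm (fderiv ℝ φ) p volume :=
    eLpNorm_congr_norm_ae (.of_forall (norm_gradient_eq_norm_fderiv φ))
  simp only [hgrad]
  have hp0 : p ≠ 0 := by rintro rfl; simp at hp
  obtain h1 | h2 : N = 1 ∨ 2 ≤ N := by omega
  · subst h1
    -- In dimension one the relation reads q⁻¹ + 1 = p⁻¹ ≤ 1, which leaves only p = 1 and q = ∞.
    have hp1 : p⁻¹ = 1 := le_antisymm (by simpa using hp) (by rw [← hpq]; simp)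
    have hq1 : q = ∞ := by
      rw [hp1] at hpq
      have : q⁻¹ + 1 = 0 + 1 := by simpa using hpq
      simpa using (ENNReal.add_left_inj ENNReal.one_ne_top).1 this
    have hp1' : p = 1 := by simpa using hp1
    subst hq1 hp1'
    refine ⟨1, fun φ hφ hφ2 => ?_⟩
    rw [eLpNorm_one_eq_lintegral_enorm, eLpNorm_exponent_top, ENNReal.coe_one, one_mul]
    exact eLpNormEssSup_le_of_ae_enorm_bound
      (.of_forall (enorm_le_lintegral_enorm_fderiv_of_one hφ hφ2))
  · have hqt := hq h2
    lift p to ℝ≥0 using hpt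
    lift q to ℝ≥0 using hqt
    refine ⟨eLpNormLESNormFDerivOfEqInnerConst (volume : Measure (RN N)) p, fun φ hφ hφ2 =>
      eLpNorm_le_eLpNorm_fderiv_of_eq_inner _ hφ hφ2 (by exact_mod_cast hp) (by simp; omega) ?_⟩
    have hq0 : q ≠ 0 := by
      rintro rfl
      have : (p : ℝ≥0∞)⁻¹ = ∞ := by rw [← hpq]; simp
      simp at this; simp [this] at hp0
    have h3 := congrArg ENNReal.toReal hpq
    rw [ENNReal.toReal_add (by simpa using hq0) (by simp; omega)] at h3
    simp at h3 ⊢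
    linarith

/-! ### The space H¹₀: approximation, chain rule, Sobolev inequality. -/

theorem tendsto_eLpNorm_two_of_dominated {α E : Type*} [MeasurableSpace α] {μ : Measure α}
    [NormedAddCommGroup E] {f : ℕ → α → E} {G : α → ℝ}
    (hf : ∀ n, AEStronglyMeasurable (f n) μ) (hG : MemLp G 2 μ)
    (hle : ∀ n, ∀ᵐ x ∂μ, ‖f n x‖ ≤ G x)
    (hlim : ∀ᵐ x ∂μ, Tendsto (fun n => f n x) atTop (𝓝 0)) :
    Tendsto (fun n => eLpNorm (f n) 2 μ) atTop (𝓝 0) := by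
  have hkey : Tendsto (fun n => ∫⁻ x, ‖f n x‖ₑ ^ (2 : ℝ) ∂μ) atTop (𝓝 (∫⁻ _, 0 ∂μ)) := by
    refine tendsto_lintegral_of_dominated_convergence' (fun x => ‖G x‖ₑ ^ (2 : ℝ))
      (fun n => (hf n).enorm.pow_const _) (fun n => ?_) ?_ ?_
    · filter_upwards [hle n] with x hx
      gcongr
      rw [← ofReal_norm, ← ofReal_norm]
      exact ENNReal.ofReal_le_ofReal (hx.trans (le_abs_self _))
    · have := hG.eLpNorm_lt_top
      rw [eLpNorm_lt_top_iff_lintegral_rpow_enorm_lt_top (by simp) (by simp)] at this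
      simpa using this.ne
    · filter_upwards [hlim] with x hx
      have h1 : Tendsto (fun n => ‖f n x‖ₑ) atTop (𝓝 0) := by simpa using hx.enorm
      simpa using h1.ennrpow_const (2 : ℝ)
  have h2 := hkey.ennrpow_const (1 / 2 : ℝ)
  simp only [lintegral_zero] at h2
  rw [ENNReal.zero_rpow_of_pos (by norm_num)] at h2
  refine h2.congr fun n => ?_
  rw [eLpNorm_eq_lintegral_rpow_enorm_toReal (by simp) (by simp)]
  simp

variable {N : ℕ} {Ω : Opens (RN N)}

theorem continuous_gradient_testFunction (φ : 𝓓(Ω, ℝ)) : Continuous (∇ (φ : RN N → ℝ)) :=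
  (LinearIsometryEquiv.continuous _).comp (φ.contDiff.continuous_fderiv (by simp))

theorem hasCompactSupport_gradient_testFunction (φ : 𝓓(Ω, ℝ)) :
    HasCompactSupport (∇ (φ : RN N → ℝ)) :=
  (φ.hasCompactSupport.fderiv ℝ).comp_left (g := (InnerProductSpace.toDual ℝ (RN N)).symm) (by simp)

theorem memLp_testFunction (φ : 𝓓(Ω, ℝ)) (p : ℝ≥0∞) : MemLp φ p volume :=
  φ.continuous.memLp_of_hasCompactSupport φ.hasCompactSupport

theorem memLp_gradient_testFunction (φ : 𝓓(Ω, ℝ)) (p : ℝ≥0∞) :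
    MemLp (∇ (φ : RN N → ℝ)) p volume :=
  (continuous_gradient_testFunction φ).memLp_of_hasCompactSupport
    (hasCompactSupport_gradient_testFunction φ)

theorem support_testFunction_subset (φ : 𝓓(Ω, ℝ)) : Function.support φ ⊆ (Ω : Set (RN N)) :=
  (subset_tsupport _).trans φ.tsupport_subset

theorem support_gradient_testFunction_subset (φ : 𝓓(Ω, ℝ)) :
    Function.support (∇ (φ : RN N → ℝ)) ⊆ (Ω : Set (RN N)) := by
  refine Set.Subset.trans ?_ ((support_fderiv_subset ℝ).trans φ.tsupport_subset)
  intro x hx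
  simpa [gradient] using hx

/-- Integration by parts for two test functions. -/
theorem integral_testFunction_smul_gradient (φ ψ : 𝓓(Ω, ℝ)) :
    ∫ x in (Ω : Set (RN N)), φ x • ∇ (ψ : RN N → ℝ) x
      = - ∫ x in (Ω : Set (RN N)), ψ x • ∇ (φ : RN N → ℝ) x := by
  have hint (φ ψ : 𝓓(Ω, ℝ)) : Integrable (fun x => φ x • ∇ (ψ : RN N → ℝ) x) volume :=
    (φ.continuous.smul (continuous_gradient_testFunction ψ)).integrable_of_hasCompactSupport
      φ.hasCompactSupport.smul_right
  have hset (φ ψ : 𝓓(Ω, ℝ)) : ∫ x in (Ω : Set (RN N)), φ x • ∇ (ψ : RN N → ℝ) x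
      = ∫ x, φ x • ∇ (ψ : RN N → ℝ) x := by
    refine setIntegral_eq_integral_of_forall_compl_eq_zero fun x hx => ?_
    have : φ x = 0 := by
      by_contra h
      exact hx (support_testFunction_subset φ h)
    simp [this]
  rw [hset, hset]
  refine ext_inner_left ℝ fun v => ?_
  rw [inner_neg_right, ← integral_inner (hint φ ψ), ← integral_inner (hint ψ φ)]
  have hinner (f : RN N → ℝ) (x : RN N) : inner ℝ v (∇ f x) = fderiv ℝ f x v := by
    rw [real_inner_comm, gradient, InnerProductSpace.toDual_symm_apply]
  have hi (φ ψ : 𝓓(Ω, ℝ)) : Integrable (fun x => φ x * fderiv ℝ (ψ : RN N → ℝ) x v) volume := by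
    have := (hint φ ψ).const_inner (𝕜 := ℝ) v
    simpa [inner_smul_right, hinner] using this
  simp only [inner_smul_right, hinner]
  have h := integral_mul_fderiv_eq_neg_fderiv_mul_of_integrable (μ := (volume : Measure (RN N)))
    (f := φ) (g := ψ) (v := v) (by simpa [mul_comm] using hi ψ φ) (hi φ ψ)
    ((φ.continuous.mul ψ.continuous).integrable_of_hasCompactSupport
      φ.hasCompactSupport.mul_right)
    (fun x _ => φ.contDiff.differentiable (by simp) x)
    (fun x _ => ψ.contDiff.differentiable (by simp) x)
  simpa [mul_comm] using h

/-- A limit in the norm of `H¹` of test functions belongs to `H¹₀`. -/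
theorem MemH10.of_approx {u : RN N → ℝ} {Du : RN N → RN N}
    (hΩ : volume (Ω : Set (RN N)) ≠ ∞) (hu : MemLp u 2 (volume.restrict Ω))
    (hDu : MemLp Du 2 (volume.restrict Ω))
    (happ : ∃ φ : ℕ → 𝓓(Ω, ℝ),
      Tendsto (fun n => eLpNorm (fun x => u x - φ n x) 2 (volume.restrict Ω)) atTop (𝓝 0) ∧
      Tendsto (fun n => eLpNorm (fun x => Du x - ∇ (φ n : RN N → ℝ) x) 2 (volume.restrict Ω))
        atTop (𝓝 0)) : MemH10 Ω u Du := by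
  have : IsFiniteMeasure (volume.restrict (Ω : Set (RN N))) :=
    isFiniteMeasure_restrict.2 hΩ
  refine ⟨⟨hu, hDu, ?_, ?_, fun ψ => ?_⟩, happ⟩
  · exact IntegrableOn.locallyIntegrableOn (hu.integrable (by norm_num))
  · exact IntegrableOn.locallyIntegrableOn (hDu.integrable (by norm_num))
  obtain ⟨φ, h1, h2⟩ := happ
  -- For fixed ψ, Hölder makes both sides of the integration by parts continuous under L²
  -- convergence of `φ n` and its gradient.
  have hL : Tendsto (fun n => ∫ x in (Ω : Set (RN N)), φ n x • ∇ (ψ : RN N → ℝ) x) atTop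
      (𝓝 (∫ x in (Ω : Set (RN N)), u x • ∇ (ψ : RN N → ℝ) x)) := by
    have hψ := (memLp_gradient_testFunction ψ 2).restrict (Ω : Set (RN N))
    refine tendsto_integral_of_L1' _ (hψ.smul hu : MemLp _ 1 _).1 (.of_forall fun n =>
      memLp_one_iff_integrable.1 (hψ.smul ((memLp_testFunction (φ n) 2).restrict _))) ?_
    refine tendsto_of_tendsto_of_tendsto_of_le_of_le tendsto_const_nhds
      (g := fun _ => 0) (by simpa using
        ENNReal.Tendsto.mul_const h1 (.inr hψ.eLpNorm_ne_top)) (fun _ => zero_le) fun n => ?_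
    have := eLpNorm_smul_le_mul_eLpNorm (r := 1) (p := 2) (q := 2) hψ.1
      (hu.sub ((memLp_testFunction (φ n) 2).restrict (Ω : Set (RN N)))).1
    refine le_trans (le_of_eq ?_) this
    rw [← eLpNorm_neg]
    congr 1
    ext1 x
    simp [sub_smul]
  have hR : Tendsto (fun n => ∫ x in (Ω : Set (RN N)), ψ x • ∇ (φ n : RN N → ℝ) x) atTop
      (𝓝 (∫ x in (Ω : Set (RN N)), ψ x • Du x)) := by
    have hψ := (memLp_testFunction ψ 2).restrict (Ω : Set (RN N))
    refine tendsto_integral_of_L1' _ (hDu.smul hψ : MemLp _ 1 _).1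
      (.of_forall fun n => memLp_one_iff_integrable.1
        (((memLp_gradient_testFunction (φ n) 2).restrict _).smul hψ)) ?_
    refine tendsto_of_tendsto_of_tendsto_of_le_of_le tendsto_const_nhds
      (g := fun _ => 0) (by simpa using
        ENNReal.Tendsto.const_mul h2 (.inr hψ.eLpNorm_ne_top)) (fun _ => zero_le) fun n => ?_
    have := eLpNorm_smul_le_mul_eLpNorm (r := 1) (p := 2) (q := 2)
      (hDu.sub ((memLp_gradient_testFunction (φ n) 2).restrict (Ω : Set (RN N)))).1 hψ.1
    refine le_trans (le_of_eq ?_) this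
    rw [← eLpNorm_neg]
    congr 1
    ext1 x
    simp [smul_sub]
  refine tendsto_nhds_unique hL ?_
  exact hR.neg.congr fun n => (integral_testFunction_smul_gradient (φ n) ψ).symm

/-- `H¹₀` functions are approximated by test functions in `H¹` and almost everywhere. -/
theorem MemH10.exists_approx_ae {u : RN N → ℝ} {Du : RN N → RN N} (hu : MemH10 Ω u Du) :
    ∃ φ : ℕ → 𝓓(Ω, ℝ),
      Tendsto (fun n => eLpNorm (fun x => u x - φ n x) 2 (volume.restrict Ω)) atTop (𝓝 0) ∧
      Tendsto (fun n => eLpNorm (fun x => Du x - ∇ (φ n : RN N → ℝ) x) 2 (volume.restrict Ω))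
        atTop (𝓝 0) ∧
      ∀ᵐ x ∂(volume.restrict (Ω : Set (RN N))), Tendsto (fun n => φ n x) atTop (𝓝 (u x)) := by
  obtain ⟨φ, h1, h2⟩ := hu.approx
  have h3 : TendstoInMeasure (volume.restrict (Ω : Set (RN N))) (fun n => (φ n : RN N → ℝ))
      atTop u := by
    refine tendstoInMeasure_of_tendsto_eLpNorm (p := 2) (by simp)
      (fun n => (φ n).continuous.aestronglyMeasurable) hu.memLp.1 (h1.congr fun n => ?_)
    rw [← eLpNorm_neg]
    congr 1
    ext1 x
    simp
  obtain ⟨ns, hns, h4⟩ := h3.exists_seq_tendsto_ae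
  exact ⟨fun n => φ (ns n), h1.comp hns.tendsto_atTop, h2.comp hns.tendsto_atTop, h4⟩

/-- Composition of a test function with a smooth function vanishing at `0`. -/
noncomputable def compTestFunction (g : ℝ → ℝ) (hg : ContDiff ℝ (⊤ : ℕ∞) g) (hg0 : g 0 = 0) (φ : 𝓓(Ω, ℝ)) :
    𝓓(Ω, ℝ) where
  toFun := g ∘ φ
  contDiff' := hg.comp φ.contDiff
  hasCompactSupport' := φ.hasCompactSupport.comp_left hg0
  tsupport_subset' := (tsupport_comp_subset hg0 _).trans φ.tsupport_subset

theorem gradient_compTestFunction (g : ℝ → ℝ) (hg : ContDiff ℝ (⊤ : ℕ∞) g) (hg0 : g 0 = 0)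
    (φ : 𝓓(Ω, ℝ)) (x : RN N) :
    ∇ (compTestFunction g hg hg0 φ : RN N → ℝ) x = deriv g (φ x) • ∇ (φ : RN N → ℝ) x := by
  have h1 : HasFDerivAt (g ∘ φ) (deriv g (φ x) • fderiv ℝ (φ : RN N → ℝ) x) x :=
    (hg.differentiable (by simp) (φ x)).hasDerivAt.comp_hasFDerivAt x
      (φ.contDiff.differentiable (by simp) x).hasFDerivAt
  have h2 : fderiv ℝ (compTestFunction g hg hg0 φ : RN N → ℝ) x = _ := h1.fderiv
  rw [gradient, h2]
  simp [gradient]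

/-- The chain rule in `H¹₀`. -/
theorem MemH10.comp {u : RN N → ℝ} {Du : RN N → RN N} (hΩ : volume (Ω : Set (RN N)) ≠ ∞)
    (hu : MemH10 Ω u Du) {g : ℝ → ℝ} (hg : ContDiff ℝ (⊤ : ℕ∞) g) (hg0 : g 0 = 0)
    (hg1 : ∀ s, |deriv g s| ≤ 1) :
    MemH10 Ω (fun x => g (u x)) (fun x => deriv g (u x) • Du x) := by
  have hlip (a b : ℝ) : ‖g a - g b‖ ≤ 1 * ‖a - b‖ :=
    Convex.norm_image_sub_le_of_norm_deriv_le (fun x _ => hg.differentiable (by simp) x)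
      (fun x _ => hg1 x) convex_univ (Set.mem_univ _) (Set.mem_univ _)
  have hg' : Continuous (deriv g) := hg.continuous_deriv (by simp)
  have hum := hu.memLp.1
  have hDum := hu.memLp_grad.1
  have hg'u : AEStronglyMeasurable (fun x => deriv g (u x)) (volume.restrict (Ω : Set (RN N))) :=
    hg'.comp_aestronglyMeasurable hum
  obtain ⟨φ, h1, h2, h3⟩ := hu.exists_approx_ae
  refine .of_approx hΩ ?_ ?_ ⟨fun n => compTestFunction g hg hg0 (φ n), ?_, ?_⟩
  · refine hu.memLp.of_le (hg.continuous.comp_aestronglyMeasurable hum) (.of_forall fun x => ?_)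
    simpa [hg0] using hlip (u x) 0
  · refine hu.memLp_grad.of_le (hg'u.smul hDum) (.of_forall fun x => ?_)
    rw [norm_smul]
    exact mul_le_of_le_one_left (norm_nonneg _) (hg1 _)
  · refine tendsto_of_tendsto_of_tendsto_of_le_of_le tendsto_const_nhds h1
      (fun _ => zero_le) fun n => eLpNorm_mono fun x => ?_
    simpa using! hlip (u x) (φ n x)
  -- Write g'(u)Du - g'(φₙ)∇φₙ = (g'(u) - g'(φₙ))Du + g'(φₙ)(Du - ∇φₙ). The first term tends to 0 by
  -- dominated convergence, which is why a.e. convergence of φₙ is required; the second because |g'|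
  -- ≤ 1.
  · have ha : Tendsto (fun n => eLpNorm (fun x => (deriv g (u x) - deriv g (φ n x)) • Du x) 2
        (volume.restrict (Ω : Set (RN N)))) atTop (𝓝 0) := by
      refine tendsto_eLpNorm_two_of_dominated (G := fun x => 2 * ‖Du x‖) (fun n =>
        (hg'u.sub (hg'.comp (φ n).continuous).aestronglyMeasurable).smul hDum)
        (hu.memLp_grad.norm.const_mul 2) (fun n => .of_forall fun x => ?_) ?_
      · rw [norm_smul]
        gcongr
        calc _ ≤ |deriv g (u x)| + |deriv g (φ n x)| := abs_sub _ _
          _ ≤ 2 := by linarith [hg1 (u x), hg1 (φ n x)]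
      · filter_upwards [h3] with x hx
        have := ((tendsto_const_nhds (x := deriv g (u x))).sub
          ((hg'.tendsto (u x)).comp hx)).smul_const (Du x)
        simpa using this
    have hsum := ha.add h2
    rw [add_zero] at hsum
    refine tendsto_of_tendsto_of_tendsto_of_le_of_le tendsto_const_nhds hsum
      (fun _ => zero_le) fun n => ?_
    have hd : AEStronglyMeasurable (fun x => Du x - ∇ (φ n : RN N → ℝ) x)
        (volume.restrict (Ω : Set (RN N))) :=
      hDum.sub (continuous_gradient_testFunction (φ n)).aestronglyMeasurable
    have hφm : AEStronglyMeasurable (fun x => deriv g (φ n x))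
        (volume.restrict (Ω : Set (RN N))) := (hg'.comp (φ n).continuous).aestronglyMeasurable
    calc _ = eLpNorm ((fun x => (deriv g (u x) - deriv g (φ n x)) • Du x) +
          fun x => deriv g (φ n x) • (Du x - ∇ (φ n : RN N → ℝ) x)) 2
          (volume.restrict (Ω : Set (RN N))) := by
          congr 1
          ext1 x
          rw [gradient_compTestFunction, Pi.add_apply, sub_smul, smul_sub]
          abel
      _ ≤ eLpNorm (fun x => (deriv g (u x) - deriv g (φ n x)) • Du x) 2
            (volume.restrict (Ω : Set (RN N))) +
          eLpNorm (fun x => deriv g (φ n x) • (Du x - ∇ (φ n : RN N → ℝ) x)) 2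
            (volume.restrict (Ω : Set (RN N))) :=
          eLpNorm_add_le ((hg'u.sub hφm).smul hDum) (hφm.smul hd) (by norm_num)
      _ ≤ _ := by
          refine add_le_add le_rfl (eLpNorm_mono fun x => ?_)
          rw [norm_smul]
          exact mul_le_of_le_one_left (norm_nonneg _) (hg1 _)

/-- A Sobolev inequality for test functions extends to `H¹₀`. -/
theorem MemH10.sobolev {u : RN N → ℝ} {Du : RN N → RN N} (hΩ : volume (Ω : Set (RN N)) ≠ ∞)
    (hu : MemH10 Ω u Du) {p q : ℝ≥0∞} (hp : 1 ≤ p) (hp2 : p ≤ 2) {S : ℝ≥0}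
    (hS : ∀ φ : RN N → ℝ, ContDiff ℝ 1 φ → HasCompactSupport φ →
      eLpNorm φ q volume ≤ S * eLpNorm (∇ φ) p volume) :
    eLpNorm u q (volume.restrict Ω) ≤ S * eLpNorm Du p (volume.restrict Ω) := by
  have : IsFiniteMeasure (volume.restrict (Ω : Set (RN N))) :=
    isFiniteMeasure_restrict.2 hΩ
  obtain ⟨φ, h1, h2, h3⟩ := hu.exists_approx_ae
  have hd (n : ℕ) : AEStronglyMeasurable (fun x => Du x - ∇ (φ n : RN N → ℝ) x)
      (volume.restrict (Ω : Set (RN N))) :=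
    hu.memLp_grad.1.sub (continuous_gradient_testFunction (φ n)).aestronglyMeasurable
  have hlim : Tendsto (fun n => eLpNorm (fun x => Du x - ∇ (φ n : RN N → ℝ) x) p
      (volume.restrict (Ω : Set (RN N)))) atTop (𝓝 0) := by
    refine tendsto_of_tendsto_of_tendsto_of_le_of_le tendsto_const_nhds
      (h := fun n => _ * _)
      ?_ (fun _ => zero_le) fun n =>
        eLpNorm_le_eLpNorm_mul_rpow_measure_univ hp2 (hd n)
    have hexp : 0 ≤ 1 / p.toReal - 1 / (2 : ℝ≥0∞).toReal := by
      have hpt : p ≠ ∞ := ne_top_of_le_ne_top (by simp) hp2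
      have h2 : p.toReal ≤ 2 := by simpa using ENNReal.toReal_mono (by simp) hp2
      have h1 : 1 ≤ p.toReal := by simpa using ENNReal.toReal_mono hpt hp
      simp only [ENNReal.toReal_ofNat, sub_nonneg]
      gcongr
    simpa using ENNReal.Tendsto.mul_const h2
      (.inr (ENNReal.rpow_ne_top_of_nonneg hexp (measure_ne_top (volume.restrict (Ω : Set (RN N))) Set.univ)))
  have hbound (n : ℕ) : eLpNorm (φ n) q (volume.restrict (Ω : Set (RN N))) ≤
      S * (eLpNorm Du p (volume.restrict (Ω : Set (RN N))) +
        eLpNorm (fun x => Du x - ∇ (φ n : RN N → ℝ) x) p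
          (volume.restrict (Ω : Set (RN N)))) := by
    rw [eLpNorm_restrict_eq_of_support_subset (support_testFunction_subset (φ n))]
    refine (hS _ ((φ n).contDiff.of_le (by simp)) (φ n).hasCompactSupport).trans ?_
    gcongr
    rw [← eLpNorm_restrict_eq_of_support_subset (support_gradient_testFunction_subset (φ n))]
    refine le_trans (le_of_eq ?_) (eLpNorm_sub_le hu.memLp_grad.1 (hd n) hp)
    congr 1
    ext1 x
    simp
  have hlim2 : Tendsto (fun n => S * (eLpNorm Du p (volume.restrict (Ω : Set (RN N))) +
        eLpNorm (fun x => Du x - ∇ (φ n : RN N → ℝ) x) p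
          (volume.restrict (Ω : Set (RN N))))) atTop
        (𝓝 (S * eLpNorm Du p (volume.restrict (Ω : Set (RN N))))) := by
    simpa using ENNReal.Tendsto.const_mul (tendsto_const_nhds.add hlim) (.inr ENNReal.coe_ne_top)
  -- Lower semicontinuity of the norm under a.e. convergence avoids assuming u ∈ L^q and also covers
  -- q = ∞.
  calc _ ≤ atTop.liminf fun n => eLpNorm (φ n) q (volume.restrict (Ω : Set (RN N))) :=
        Lp.eLpNorm_lim_le_liminf_eLpNorm
          (fun n => (φ n).continuous.aestronglyMeasurable) _ h3
    _ ≤ _ := liminf_le_liminf (.of_forall hbound)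
    _ = _ := hlim2.liminf_eq

/-! ### Smooth truncations. -/

/-- A smooth convex function vanishing on `(-∞, 0]` with slope between `0` and `1`. -/
noncomputable def smoothRamp (s : ℝ) : ℝ := ∫ y in (0 : ℝ)..s, Real.smoothTransition y

theorem hasDerivAt_smoothRamp (s : ℝ) :
    HasDerivAt smoothRamp (Real.smoothTransition s) s :=
  intervalIntegral.integral_hasDerivAt_right
    (Real.smoothTransition.continuous.intervalIntegrable _ _)
    Real.smoothTransition.continuous.stronglyMeasurable.stronglyMeasurableAtFilter
    Real.smoothTransition.continuous.continuousAt

theorem contDiff_smoothRamp : ContDiff ℝ (⊤ : ℕ∞) smoothRamp := by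
  refine contDiff_infty_iff_deriv.2 ⟨fun s => (hasDerivAt_smoothRamp s).differentiableAt, ?_⟩
  rw [show deriv smoothRamp = Real.smoothTransition from
    funext fun s => (hasDerivAt_smoothRamp s).deriv]
  exact Real.smoothTransition.contDiff

theorem smoothRamp_of_nonpos {s : ℝ} (hs : s ≤ 0) : smoothRamp s = 0 := by
  rw [smoothRamp, intervalIntegral.integral_congr (g := fun _ => 0), intervalIntegral.integral_zero]
  intro y hy
  rw [Set.uIcc_of_ge hs] at hy
  exact Real.smoothTransition.zero_of_nonpos hy.2

theorem monotone_smoothRamp : Monotone smoothRamp :=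
  monotone_of_deriv_nonneg (fun s => (hasDerivAt_smoothRamp s).differentiableAt) fun s => by
    rw [(hasDerivAt_smoothRamp s).deriv]
    exact Real.smoothTransition.nonneg s

theorem smoothRamp_nonneg (s : ℝ) : 0 ≤ smoothRamp s := by
  rcases le_total s 0 with hs | hs
  · exact (smoothRamp_of_nonpos hs).ge
  · simpa [smoothRamp_of_nonpos le_rfl] using monotone_smoothRamp hs

theorem smoothRamp_one_pos : 0 < smoothRamp 1 :=
  intervalIntegral.intervalIntegral_pos_of_pos_on
    (Real.smoothTransition.continuous.intervalIntegrable _ _)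
    (fun _ hy => Real.smoothTransition.pos_of_pos hy.1) one_pos

/-- A smooth substitute for the truncation `s ↦ (s - k)⁺`, with transition on `[k, k + d]`. -/
noncomputable def smoothTrunc (k d s : ℝ) : ℝ := d * smoothRamp ((s - k) / d)

section smoothTrunc

variable {k d : ℝ}

theorem hasDerivAt_smoothTrunc (hd : 0 < d) (s : ℝ) :
    HasDerivAt (smoothTrunc k d) (Real.smoothTransition ((s - k) / d)) s := by
  have h1 : HasDerivAt (fun s => (s - k) / d) (1 / d) s :=
    ((hasDerivAt_id s).sub_const k).div_const d
  have h2 := ((hasDerivAt_smoothRamp ((s - k) / d)).comp s h1).const_mul d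
  convert! h2 using 1
  field_simp

theorem deriv_smoothTrunc (hd : 0 < d) (s : ℝ) :
    deriv (smoothTrunc k d) s = Real.smoothTransition ((s - k) / d) :=
  (hasDerivAt_smoothTrunc hd s).deriv

theorem contDiff_smoothTrunc : ContDiff ℝ (⊤ : ℕ∞) (smoothTrunc k d) :=
  contDiff_const.mul (contDiff_smoothRamp.comp ((contDiff_id.sub contDiff_const).div_const d))

theorem smoothTrunc_nonneg (hd : 0 < d) (s : ℝ) : 0 ≤ smoothTrunc k d s :=
  mul_nonneg hd.le (smoothRamp_nonneg _)

theorem smoothTrunc_of_le (hd : 0 < d) {s : ℝ} (hs : s ≤ k) : smoothTrunc k d s = 0 := by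
  rw [smoothTrunc, smoothRamp_of_nonpos (div_nonpos_of_nonpos_of_nonneg (by linarith) hd.le),
    mul_zero]

/-- The lower bound behind Markov's inequality: the sharp truncation would give d here, and
smoothing costs the fixed factor `smoothRamp 1`. -/
theorem le_smoothTrunc (hd : 0 < d) {s : ℝ} (hs : k + d ≤ s) :
    d * smoothRamp 1 ≤ smoothTrunc k d s :=
  mul_le_mul_of_nonneg_left (monotone_smoothRamp ((one_le_div hd).2 (by linarith))) hd.le

end smoothTrunc

/-! ### Energy estimate and decay of superlevel sets. -/

theorem CoerciveMatrix.integrable_inner {A : RN N → Matrix (Fin N) (Fin N) ℝ} {α : ℝ}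
    (hA : CoerciveMatrix Ω A α) {ξ η : RN N → RN N} (hξ : MemLp ξ 2 (volume.restrict Ω))
    (hη : MemLp η 2 (volume.restrict Ω)) :
    Integrable (fun x => inner ℝ ((A x).toEuclideanLin (ξ x)) (η x)) (volume.restrict Ω) := by
  have hco {ζ : RN N → RN N} (hζ : MemLp ζ 2 (volume.restrict Ω)) (i : Fin N) :
      MemLp (fun x => ζ x i) 2 (volume.restrict Ω) := by
    have := (EuclideanSpace.proj i : RN N →L[ℝ] ℝ).comp_memLp' hζ
    simpa using! this
  have heq : (fun x => inner ℝ ((A x).toEuclideanLin (ξ x)) (η x)) =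
      fun x => ∑ i, ∑ j, (A x i j * ξ x j) * η x i := by
    ext x
    simp [PiLp.inner_apply, Matrix.mulVec, dotProduct, Finset.mul_sum, mul_comm]
  rw [heq]
  refine integrable_finsetSum _ fun i _ => integrable_finsetSum _ fun j _ => ?_
  have h1 : MemLp (fun x => A x i j * ξ x j) 2 (volume.restrict Ω) :=
    (hco hξ j).mul (hA.memLp_top i j)
  exact h1.integrable_mul (hco hη i)

theorem integral_norm_sq_eq_toReal_eLpNorm_sq {α E : Type*} [MeasurableSpace α] {μ : Measure α}
    [NormedAddCommGroup E] {f : α → E} (hf : MemLp f 2 μ) :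
    ∫ x, ‖f x‖ ^ 2 ∂μ = (eLpNorm f 2 μ).toReal ^ 2 := by
  rw [hf.eLpNorm_eq_integral_rpow_norm (by simp) (by simp), ENNReal.toReal_ofReal (by positivity)]
  have h0 : 0 ≤ ∫ x, ‖f x‖ ^ 2 ∂μ := integral_nonneg fun x => by positivity
  simp only [ENNReal.toReal_ofNat, Real.rpow_ofNat]
  rw [← Real.rpow_natCast, ← Real.rpow_mul h0]
  norm_num

/-- The energy estimate for the truncation of a solution above a level `k ≥ 1`. -/
theorem energy_smoothTrunc {A : RN N → Matrix (Fin N) (Fin N) ℝ} {α : ℝ}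
    (hA : CoerciveMatrix Ω A α) {F : RN N → ℝ≥0 → ℝ≥0∞} {γ : ℝ} {h : RN N → ℝ}
    (hF : GrowthCondition Ω F γ h) {u : RN N → ℝ} {Du : RN N → RN N}
    (hu : MemLp Du 2 (volume.restrict Ω)) {k d : ℝ} (hk : 1 ≤ k) (hd : 0 < d)
    {Dv : RN N → RN N} (hDv : Dv = fun x => deriv (smoothTrunc k d) (u x) • Du x)
    (hDv2 : MemLp Dv 2 (volume.restrict Ω))
    (hint : ∫ x in (Ω : Set (RN N)), inner ℝ ((A x).toEuclideanLin (Du x)) (Dv x)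
        = (∫⁻ x in (Ω : Set (RN N)), F x (u x).toNNReal *
            ENNReal.ofReal (smoothTrunc k d (u x))).toReal)
    {τ q : ℝ≥0∞} [ENNReal.HolderConjugate τ q] (hh : MemLp h τ (volume.restrict Ω))
    (hv : MemLp (fun x => smoothTrunc k d (u x)) q (volume.restrict Ω)) :
    α * (eLpNorm Dv 2 (volume.restrict Ω)).toReal ^ 2 ≤
      2 * ((eLpNorm h τ (volume.restrict Ω)).toReal *
        (eLpNorm (fun x => smoothTrunc k d (u x)) q (volume.restrict Ω)).toReal) := by
  have hlow : α * (eLpNorm Dv 2 (volume.restrict Ω)).toReal ^ 2 ≤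
      ∫ x in (Ω : Set (RN N)), inner ℝ ((A x).toEuclideanLin (Du x)) (Dv x) := by
    rw [← integral_norm_sq_eq_toReal_eLpNorm_sq hDv2, ← integral_const_mul]
    refine integral_mono_ae ((hDv2.integrable_norm_pow two_ne_zero).const_mul α)
      (hA.integrable_inner hu hDv2) ?_
    filter_upwards [hA.coercive] with x hx
    have h0 := Real.smoothTransition.nonneg ((u x - k) / d)
    have h1 := Real.smoothTransition.le_one ((u x - k) / d)
    simp only [hDv, norm_smul, deriv_smoothTrunc hd, inner_smul_right, Real.norm_eq_abs,
      abs_of_nonneg h0]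
    set T := Real.smoothTransition ((u x - k) / d)
    -- Since 0 ≤ T ≤ 1, T² ≤ T: the energy of v is controlled by the mixed term with Du and Dv.
    calc α * (T * ‖Du x‖) ^ 2 = T * (T * (α * ‖Du x‖ ^ 2)) := by ring
      _ ≤ 1 * (T * (α * ‖Du x‖ ^ 2)) := by
          have := hA.pos
          gcongr
      _ = T * (α * ‖Du x‖ ^ 2) := one_mul _
      _ ≤ _ := by gcongr; exact hx _
  have hup : ∫⁻ x in (Ω : Set (RN N)), F x (u x).toNNReal *
      ENNReal.ofReal (smoothTrunc k d (u x)) ≤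
      2 * (eLpNorm h τ (volume.restrict Ω) *
        eLpNorm (fun x => smoothTrunc k d (u x)) q (volume.restrict Ω)) := by
    have hhol := eLpNorm_smul_le_mul_eLpNorm (p := τ) (q := q) (r := 1) hv.1 hh.1
    rw [eLpNorm_one_eq_lintegral_enorm] at hhol
    refine le_trans ?_ (mul_le_mul_right hhol 2)
    rw [← lintegral_const_mul' _ _ (by simp)]
    refine lintegral_mono_ae ?_
    filter_upwards [hF.nonneg, hF.bound] with x hx hb
    -- Below the level the test function vanishes, so even F = ∞ contributes nothing.
    rcases le_or_gt (u x) k with hle | hgt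
    · simp [smoothTrunc_of_le hd hle]
    · have hpos : 0 < u x := by linarith
      have h1 := hb (u x).toNNReal (by simpa using hpos)
      rw [Real.coe_toNNReal _ hpos.le] at h1
      -- Here k ≥ 1 removes the singularity; the resulting bound F ≤ 2h is the source of the 2 in
      -- 2/α.
      have h2 : 1 / u x ^ γ ≤ 1 :=
        (div_le_one (by positivity)).2 (Real.one_le_rpow (by linarith) hF.gamma_pos.le)
      have h3 : F x (u x).toNNReal ≤ ENNReal.ofReal (2 * h x) := by
        refine h1.trans (ENNReal.ofReal_le_ofReal ?_)
        nlinarith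
      have h4 : 2 * ‖h x * smoothTrunc k d (u x)‖ₑ =
          ENNReal.ofReal (2 * h x) * ENNReal.ofReal (smoothTrunc k d (u x)) := by
        rw [Real.enorm_eq_ofReal (mul_nonneg hx (smoothTrunc_nonneg hd _)),
          ENNReal.ofReal_mul hx, ENNReal.ofReal_mul (by norm_num), mul_assoc]
        simp
      simp only [Pi.smul_apply', smul_eq_mul]
      rw [h4]
      gcongr
  refine hlow.trans (hint.trans_le ?_)
  have := ENNReal.toReal_mono (by
    have := hh.eLpNorm_ne_top
    have := hv.eLpNorm_ne_top
    finiteness) hup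
  simpa using this

/-- Functions supported in `s` satisfy Hölder's inequality with the measure of `s`. -/
theorem toReal_eLpNorm_le_of_support_subset {α E : Type*} [MeasurableSpace α] {μ : Measure α}
    [IsFiniteMeasure μ] [NormedAddCommGroup E] {f : α → E} {s : Set α} {p q : ℝ≥0∞}
    (hp : 1 ≤ p) (hpq : p ≤ q) (hf : MemLp f q μ) (hs : Function.support f ⊆ s) :
    (eLpNorm f p μ).toReal ≤
      (eLpNorm f q μ).toReal * μ.real s ^ (1 / p.toReal - 1 / q.toReal) := by
  have hexp : 0 ≤ 1 / p.toReal - 1 / q.toReal := by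
    rcases eq_or_ne q ∞ with rfl | hq
    · simp
    · have h2 : p.toReal ≤ q.toReal := ENNReal.toReal_mono hq hpq
      have h1 : 1 ≤ p.toReal := by
        simpa using ENNReal.toReal_mono (ne_top_of_le_ne_top hq hpq) hp
      rw [sub_nonneg]
      gcongr
  have h1 := eLpNorm_le_eLpNorm_mul_rpow_measure_univ (μ := μ.restrict s) hpq hf.1.restrict
  rw [eLpNorm_restrict_eq_of_support_subset hs, eLpNorm_restrict_eq_of_support_subset hs,
    Measure.restrict_apply_univ] at h1
  have h2 := ENNReal.toReal_mono (ENNReal.mul_ne_top hf.eLpNorm_ne_top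
    (ENNReal.rpow_ne_top_of_nonneg hexp (measure_ne_top _ _))) h1
  rwa [ENNReal.toReal_mul, ← ENNReal.toReal_rpow] at h2

/-- The decay estimate for the measure of the superlevel sets of a solution. -/
theorem IsSolution.measureReal_superlevel_le {A : RN N → Matrix (Fin N) (Fin N) ℝ} {α : ℝ}
    (hΩ : volume (Ω : Set (RN N)) ≠ ∞)
    (hA : CoerciveMatrix Ω A α) {F : RN N → ℝ≥0 → ℝ≥0∞} {γ : ℝ} {h : RN N → ℝ}
    (hF : GrowthCondition Ω F γ h) {u : RN N → ℝ} (hu : IsSolution Ω A F u)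
    {τ p q : ℝ≥0∞} [ENNReal.HolderConjugate τ q] (hh : MemLp h τ (volume.restrict Ω))
    (hp : 1 ≤ p) (hp2 : p ≤ 2) (hq : 1 ≤ q) {S : ℝ≥0}
    (hS : ∀ φ : RN N → ℝ, ContDiff ℝ 1 φ → HasCompactSupport φ →
      eLpNorm φ q volume ≤ S * eLpNorm (∇ φ) p volume)
    {k d : ℝ} (hk : 1 ≤ k) (hd : 0 < d) :
    d * smoothRamp 1 * (volume.restrict (Ω : Set (RN N))).real {x | k + d < u x} ≤
      S ^ 2 * (2 / α) * (eLpNorm h τ (volume.restrict Ω)).toReal *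
        (volume.restrict (Ω : Set (RN N))).real {x | k < u x} ^
          (2 / p.toReal - 1 / q.toReal) := by
  have : IsFiniteMeasure (volume.restrict (Ω : Set (RN N))) := isFiniteMeasure_restrict.2 hΩ
  obtain ⟨Du, hu1, -, hsol⟩ := hu
  set v : RN N → ℝ := fun x => smoothTrunc k d (u x) with hv
  set Dv : RN N → RN N := fun x => deriv (smoothTrunc k d) (u x) • Du x with hDv
  have hvH : MemH10 Ω v Dv := hu1.comp hΩ contDiff_smoothTrunc
    (smoothTrunc_of_le hd (by linarith)) fun s => by
      rw [deriv_smoothTrunc hd, abs_of_nonneg (Real.smoothTransition.nonneg _)]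
      exact Real.smoothTransition.le_one _
  have hvsupp : Function.support v ⊆ {x | k < u x} := fun x hx => by
    by_contra hle
    exact hx (smoothTrunc_of_le hd (not_lt.1 hle))
  have hDvsupp : Function.support Dv ⊆ {x | k < u x} := fun x hx => by
    by_contra hle
    refine hx ?_
    simp only [Set.mem_ofPred_eq, not_lt] at hle
    simp only [hDv]
    rw [deriv_smoothTrunc hd, Real.smoothTransition.zero_of_nonpos
      (div_nonpos_of_nonpos_of_nonneg (by linarith) hd.le), zero_smul]
  have hsob := hvH.sobolev hΩ hp hp2 hS
  have hDvp : MemLp Dv p (volume.restrict (Ω : Set (RN N))) := hvH.memLp_grad.mono_exponent hp2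
  have hvq : MemLp v q (volume.restrict (Ω : Set (RN N))) :=
    ⟨hvH.memLp.1, hsob.trans_lt (ENNReal.mul_lt_top ENNReal.coe_lt_top hDvp.eLpNorm_lt_top)⟩
  have henergy := energy_smoothTrunc hA hF hu1.memLp_grad hk hd hDv hvH.memLp_grad
    (hsol v Dv hvH (.of_forall fun x => smoothTrunc_nonneg hd _)).2 hh hvq
  have hsob' := ENNReal.toReal_mono
    (ENNReal.mul_ne_top ENNReal.coe_ne_top hDvp.eLpNorm_ne_top) hsob
  rw [ENNReal.toReal_mul, ENNReal.coe_toReal] at hsob'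
  have hP := toReal_eLpNorm_le_of_support_subset hp hp2 hvH.memLp_grad hDvsupp
  have hv1 := toReal_eLpNorm_le_of_support_subset le_rfl hq hvq hvsupp
  have hmarkov : d * smoothRamp 1 *
      (volume.restrict (Ω : Set (RN N))).real {x | k + d < u x} ≤
      (eLpNorm v 1 (volume.restrict (Ω : Set (RN N)))).toReal := by
    have h1 := mul_meas_ge_le_lintegral₀ hvq.1.enorm (ENNReal.ofReal (d * smoothRamp 1))
    rw [← eLpNorm_one_eq_lintegral_enorm] at h1
    have h2 : volume.restrict (Ω : Set (RN N)) {x | k + d < u x} ≤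
        volume.restrict (Ω : Set (RN N)) {x | ENNReal.ofReal (d * smoothRamp 1) ≤ ‖v x‖ₑ} := by
      refine measure_mono fun x hx => ?_
      rw [Set.mem_ofPred_eq, Real.enorm_eq_ofReal (smoothTrunc_nonneg hd _)]
      exact ENNReal.ofReal_le_ofReal (le_smoothTrunc hd (le_of_lt hx))
    have h3 := ENNReal.toReal_mono (hvq.mono_exponent hq).eLpNorm_ne_top
      ((mul_le_mul_right h2 _).trans h1)
    rwa [ENNReal.toReal_mul, ENNReal.toReal_ofReal
      (mul_nonneg hd.le smoothRamp_one_pos.le)] at h3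
  refine hmarkov.trans (hv1.trans ?_)
  simp only [ENNReal.toReal_ofNat, ENNReal.toReal_one] at hP ⊢
  set a := (volume.restrict (Ω : Set (RN N))).real {x | k < u x}
  have ha : 0 ≤ a := measureReal_nonneg
  set D := (eLpNorm Dv 2 (volume.restrict (Ω : Set (RN N)))).toReal
  have hD : 0 ≤ D := ENNReal.toReal_nonneg
  set V := (eLpNorm v q (volume.restrict (Ω : Set (RN N)))).toReal
  have hV : 0 ≤ V := ENNReal.toReal_nonneg
  set H := (eLpNorm h τ (volume.restrict (Ω : Set (RN N)))).toReal
  have hH : 0 ≤ H := ENNReal.toReal_nonneg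
  set e := 1 / p.toReal - 1 / 2
  have hα := hA.pos
  have hae : 0 ≤ a ^ e := Real.rpow_nonneg ha _
  have hSe : V ≤ S * a ^ e * D := by
    calc V ≤ S * _ := hsob'
      _ ≤ S * (D * a ^ e) := by gcongr
      _ = _ := by ring
  -- The energy estimate and Sobolev give αD² ≤ 2HS a^e D; one factor D cancels, the case D = 0
  -- being trivial.
  have hD2 : D ≤ 2 / α * H * (S * a ^ e) := by
    rcases hD.eq_or_lt with h0 | hpos
    · rw [← h0]; positivity
    · refine le_of_mul_le_mul_right ?_ hpos
      calc D * D = (α * D ^ 2) / α := by field_simp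
        _ ≤ (2 * (H * (S * a ^ e * D))) / α := by
            refine div_le_div_of_nonneg_right (henergy.trans ?_) hα.le
            gcongr
        _ = _ := by ring
  -- A null superlevel set is treated apart, since splitting the power of a below needs a > 0.
  rcases ha.eq_or_lt with h0 | hpos
  · have hμ : (volume.restrict (Ω : Set (RN N))) {x | k < u x} = 0 :=
      (measureReal_eq_zero_iff).1 h0.symm
    have hv0 : V = 0 := by
      simp only [V]
      rw [← eLpNorm_restrict_eq_of_support_subset hvsupp, Measure.restrict_eq_zero.2 hμ]
      simp
    rw [hv0, zero_mul]
    exact mul_nonneg (by positivity) (Real.rpow_nonneg ha _)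
  have hexp : a ^ (2 / p.toReal - 1 / q.toReal) = a ^ e * a ^ e * a ^ (1 / 1 - 1 / q.toReal) := by
    rw [← Real.rpow_add hpos, ← Real.rpow_add hpos]
    congr 1
    simp only [e]
    ring
  rw [hexp]
  calc V * a ^ (1 / 1 - 1 / q.toReal)
      ≤ (S * a ^ e * (2 / α * H * (S * a ^ e))) * a ^ (1 / 1 - 1 / q.toReal) := by
        gcongr
        exact hSe.trans (by gcongr)
    _ = _ := by ring

/-! ### Stampacchia iteration. -/

/-- Stampacchia's iteration lemma. -/
theorem eq_zero_of_superlevel_decay {φ : ℝ → ℝ} (hφ0 : ∀ k, 0 ≤ φ k) (hφ : Antitone φ)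
    {k₀ M δ D : ℝ} (hM : 0 ≤ M) (hδ : 0 < δ) (hD : 0 < D)
    (hdecay : ∀ k d, k₀ ≤ k → 0 < d → d * φ (k + d) ≤ M * φ k ^ (1 + δ))
    (hMD : M * 2 ^ (1 + 1 / δ) * φ k₀ ^ δ ≤ D) : φ (k₀ + D) = 0 := by
  -- Chosen so that r^δ = 1/2. Along the levels k₀ + D(1 - 2⁻ⁿ) the increments halve, and the gain
  -- (rⁿ)^δ = 2⁻ⁿ compensates exactly, so φ decays like rⁿ.
  set r : ℝ := 2 ^ (-(1 / δ)) with hr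
  have hr0 : 0 < r := by positivity
  have hr1 : r < 1 := Real.rpow_lt_one_of_one_lt_of_neg one_lt_two (by simpa using hδ)
  have hrδ (n : ℕ) : (r ^ n) ^ δ = (1 / 2) ^ n := by
    rw [← Real.rpow_natCast, ← Real.rpow_mul hr0.le, mul_comm, Real.rpow_mul hr0.le, hr,
      ← Real.rpow_mul two_pos.le, Real.rpow_natCast]
    congr 1
    rw [neg_mul, one_div_mul_cancel hδ.ne', Real.rpow_neg_one]
    norm_num
  have hMr : M * φ k₀ ^ δ ≤ D * (1 / 2) * r := by
    have h1 : (2 : ℝ) ^ (1 + 1 / δ) * ((1 / 2) * r) = 1 := by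
      rw [hr, Real.rpow_add two_pos, Real.rpow_neg two_pos.le, Real.rpow_one]
      field_simp
    calc M * φ k₀ ^ δ = (M * φ k₀ ^ δ) * (2 ^ (1 + 1 / δ) * ((1 / 2) * r)) := by
          rw [h1, mul_one]
      _ = (M * 2 ^ (1 + 1 / δ) * φ k₀ ^ δ) * ((1 / 2) * r) := by ring
      _ ≤ D * ((1 / 2) * r) := by gcongr
      _ = _ := by ring
  have hind (n : ℕ) : φ (k₀ + D * (1 - (1 / 2) ^ n)) ≤ φ k₀ * r ^ n := by
    induction n with
    | zero => simp
    | succ n ih =>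
      have hd : 0 < D * (1 / 2 : ℝ) ^ (n + 1) := by positivity
      have hk : k₀ ≤ k₀ + D * (1 - (1 / 2) ^ n) := by
        have : (1 / 2 : ℝ) ^ n ≤ 1 := pow_le_one₀ (by norm_num) (by norm_num)
        nlinarith
      have h1 := hdecay _ _ hk hd
      have h2 : k₀ + D * (1 - (1 / 2) ^ n) + D * (1 / 2) ^ (n + 1) =
          k₀ + D * (1 - (1 / 2) ^ (n + 1)) := by ring
      rw [h2] at h1
      refine le_of_mul_le_mul_left (h1.trans ?_) hd
      calc M * φ (k₀ + D * (1 - (1 / 2) ^ n)) ^ (1 + δ)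
          ≤ M * (φ k₀ * r ^ n) ^ (1 + δ) := by
            have := hφ0 (k₀ + D * (1 - (1 / 2) ^ n))
            gcongr
        _ = (M * φ k₀ ^ δ) * (φ k₀ * r ^ n * (1 / 2) ^ n) := by
            have h0 : 0 ≤ φ k₀ * r ^ n := mul_nonneg (hφ0 _) (by positivity)
            rw [Real.rpow_add' h0 (by positivity), Real.rpow_one,
              Real.mul_rpow (hφ0 _) (by positivity), hrδ]
            ring
        _ ≤ (D * (1 / 2) * r) * (φ k₀ * r ^ n * (1 / 2) ^ n) := by
            have := hφ0 k₀
            gcongr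
        _ = _ := by ring
  refine le_antisymm (ge_of_tendsto' (f := fun n : ℕ => φ k₀ * r ^ n) (x := atTop) ?_ fun n => ?_)
    (hφ0 _)
  · simpa using (tendsto_pow_atTop_nhds_zero_of_lt_one hr0.le hr1).const_mul (φ k₀)
  · refine (hφ ?_).trans (hind n)
    have : 0 ≤ (1 / 2 : ℝ) ^ n := by positivity
    nlinarith

/-! ### Choice of exponents. -/

/-- Exponents suited to the iteration: `τ` is the integrability of `h`, `q` its conjugate, and
`q` is the Sobolev exponent of `p`. -/
theorem exists_exponents {N : ℕ} {t : ℝ≥0∞} (hN : 1 ≤ N) (h1 : N = 1 → t = 1)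
    (h2 : 2 ≤ N → (N : ℝ≥0∞) / 2 < t) :
    ∃ τ p q : ℝ≥0∞, ENNReal.HolderConjugate τ q ∧ 1 ≤ τ ∧ τ ≤ t ∧ 1 ≤ p ∧ p ≤ 2 ∧ 1 ≤ q ∧
      q⁻¹ + (N : ℝ≥0∞)⁻¹ = p⁻¹ ∧ (2 ≤ N → q ≠ ∞) ∧
      ∃ δ : ℝ, 0 < δ ∧ 2 / p.toReal - 1 / q.toReal = 1 + δ := by
  have hN0 : (N : ℝ≥0∞) ≠ 0 := by simp; omega
  have hNt : (N : ℝ≥0∞) ≠ ∞ := ENNReal.natCast_ne_top N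
  -- Capping at N keeps 1/p = 1 - 1/τ + 1/N at most 1, that is p ≥ 1, while τ > N/2 is preserved.
  set τ := min t N with hτ
  have hτN : τ ≤ N := min_le_right _ _
  have hτt : τ ≠ ∞ := ne_top_of_le_ne_top hNt hτN
  have hhalf : (N : ℝ≥0∞) / 2 < N := ENNReal.half_lt_self hN0 hNt
  have hNτ : (N : ℝ≥0∞) / 2 < τ := by
    obtain h | h : N = 1 ∨ 2 ≤ N := by omega
    · refine lt_min ?_ hhalf
      simp [h1 h, h]
    · exact lt_min (h2 h) hhalf
  have hone : 2 ≤ N → 1 < τ := fun h => by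
    refine lt_of_le_of_lt ?_ hNτ
    rw [ENNReal.le_div_iff_mul_le (by simp) (by simp)]
    simpa using (by exact_mod_cast h : (2 : ℝ≥0∞) ≤ N)
  have hτ1 : 1 ≤ τ := by
    obtain h | h : N = 1 ∨ 2 ≤ N := by omega
    · simp [hτ, h1 h, h]
    · exact (hone h).le
  have hτr : (N : ℝ) / 2 < τ.toReal := by
    have := (ENNReal.toReal_lt_toReal (by finiteness) hτt).2 hNτ
    simpa using this
  have hτinv : τ⁻¹ ≤ 1 := by simpa using hτ1
  set x : ℝ := (τ⁻¹).toReal with hx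
  have hx1 : x ≤ 1 := by
    simpa only [ENNReal.toReal_one] using ENNReal.toReal_mono ENNReal.one_ne_top hτinv
  have hxN : x < 2 / N := by
    rw [hx, ENNReal.toReal_inv, ← inv_div]
    exact inv_strictAnti₀ (by positivity) hτr
  have hqx : (1 - τ⁻¹).toReal = 1 - x := by
    rw [ENNReal.toReal_sub_of_le hτinv ENNReal.one_ne_top, ENNReal.toReal_one]
  have hq0 : (1 - τ⁻¹) ≠ ∞ := by finiteness
  have hpx : (1 - τ⁻¹ + (N : ℝ≥0∞)⁻¹).toReal = 1 - x + (N : ℝ)⁻¹ := by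
    rw [ENNReal.toReal_add hq0 (by simpa using hN0), hqx]
    simp
  -- With 1/q = 1 - 1/τ and 1/p = 1/q + 1/N, one finds 2/p - 1/q = 1 + (2/N - 1/τ).
  refine ⟨τ, (1 - τ⁻¹ + (N : ℝ≥0∞)⁻¹)⁻¹, (1 - τ⁻¹)⁻¹, ?_, hτ1, min_le_left _ _, ?_, ?_, ?_,
    by simp, ?_, 2 / N - x, by linarith, ?_⟩
  · rw [ENNReal.holderConjugate_iff, inv_inv, add_tsub_cancel_of_le hτinv]
  · rw [ENNReal.one_le_inv]
    calc 1 - τ⁻¹ + (N : ℝ≥0∞)⁻¹ ≤ 1 - τ⁻¹ + τ⁻¹ := by gcongr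
      _ = 1 := tsub_add_cancel_of_le hτinv
  · rw [ENNReal.inv_le_iff_inv_le, ← ENNReal.toReal_le_toReal (by simp)
      (ENNReal.add_ne_top.2 ⟨hq0, by simpa using hN0⟩), hpx]
    simp only [ENNReal.toReal_inv, ENNReal.toReal_ofNat]
    obtain h | h : N = 1 ∨ 2 ≤ N := by omega
    · subst h
      norm_num
      linarith
    · have h3 : (N : ℝ)⁻¹ ≤ 2⁻¹ := by
        gcongr
        exact_mod_cast h
      rw [div_eq_mul_inv] at hxN
      linarith
  · rw [ENNReal.one_le_inv]
    exact tsub_le_self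
  · intro h
    rw [Ne, ENNReal.inv_eq_top, tsub_eq_zero_iff_le, not_le]
    exact ENNReal.inv_lt_one.2 (hone h)
  · rw [div_eq_mul_inv, ← ENNReal.toReal_inv, inv_inv, hpx, one_div, ← ENNReal.toReal_inv,
      inv_inv, hqx]
    ring

/-! ### The uniform bound. -/

/-- The exponents and the Sobolev constant depend on N and t alone, so C is fixed before Ω. The
measure of Ω enters only as a bound for the first superlevel set and through Hölder from L^t to L^τ.
-/
theorem exists_bound_const {N : ℕ} {t : ℝ≥0∞} (hN : 1 ≤ N) (h1 : N = 1 → t = 1)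
    (h2 : 2 ≤ N → (N : ℝ≥0∞) / 2 < t) :
    ∃ C : ℝ≥0 → ℝ≥0, Monotone C ∧
      ∀ (Ω : Opens (RN N)), Bornology.IsBounded (Ω : Set (RN N)) →
      ∀ (A : RN N → Matrix (Fin N) (Fin N) ℝ) (α : ℝ), CoerciveMatrix Ω A α →
      ∀ (F : RN N → ℝ≥0 → ℝ≥0∞) (γ : ℝ) (h : RN N → ℝ), GrowthCondition Ω F γ h →
        MemLp h t (volume.restrict Ω) →
      ∀ u : RN N → ℝ, IsSolution Ω A F u →
        MemLp u ∞ (volume.restrict Ω) ∧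
        (eLpNorm u ∞ (volume.restrict Ω)).toReal ≤
          1 + 2 / α * C (volume (Ω : Set (RN N))).toNNReal *
            (eLpNorm h t (volume.restrict Ω)).toReal := by
  obtain ⟨τ, p, q, hτq, hτ1, hτt, hp1, hp2, hq1, hpq, hqt, δ, hδ, hexp⟩ :=
    exists_exponents hN h1 h2
  obtain ⟨S, hS⟩ := exists_sobolev_const hN hp1 (ne_top_of_le_ne_top (by simp) hp2) hpq hqt
  set ε : ℝ := 1 / τ.toReal - 1 / t.toReal with hε
  have hε0 : 0 ≤ ε := by
    rcases eq_or_ne t ∞ with rfl | ht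
    · simp [hε]
    · have h3 : τ.toReal ≤ t.toReal := ENNReal.toReal_mono ht hτt
      have h4 : 1 ≤ τ.toReal := by
        simpa using ENNReal.toReal_mono (ne_top_of_le_ne_top ht hτt) hτ1
      rw [hε, sub_nonneg]
      gcongr
  have hc := smoothRamp_one_pos
  set c := smoothRamp 1
  -- The factor m^δ bounds the initial term of the iteration and m^ε is the cost of replacing ‖h‖_τ
  -- by ‖h‖_t; monotonicity in m is the nonnegativity of δ and ε.
  refine ⟨fun m => S ^ 2 * c.toNNReal⁻¹ * 2 ^ (1 + 1 / δ) * m ^ δ * m ^ ε, fun m m' hm => ?_, ?_⟩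
  · dsimp only
    gcongr
  intro Ω hΩb A α hA F γ h hF hh u hu
  have hΩ : volume (Ω : Set (RN N)) ≠ ∞ := hΩb.measure_lt_top.ne
  have : IsFiniteMeasure (volume.restrict (Ω : Set (RN N))) := isFiniteMeasure_restrict.2 hΩ
  have hα := hA.pos
  set μ := volume.restrict (Ω : Set (RN N)) with hμ
  set m : ℝ := μ.real Set.univ with hm
  have hm0 : 0 ≤ m := measureReal_nonneg
  have hmΩ : (volume (Ω : Set (RN N))).toReal = m := by
    simp [hm, hμ, Measure.real]
  set H := (eLpNorm h τ μ).toReal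
  have hH0 : 0 ≤ H := ENNReal.toReal_nonneg
  have hH : H ≤ (eLpNorm h t μ).toReal * m ^ ε :=
    toReal_eLpNorm_le_of_support_subset hτ1 hτt hh (Set.subset_univ _)
  set M : ℝ := S ^ 2 * (2 / α) * H / c with hMdef
  have hM0 : 0 ≤ M := by positivity
  -- The strict inequality secures D > 0 even when M = 0; the optimal value is recovered below by
  -- letting the excess η tend to 0.
  have hbound : ∀ D, M * 2 ^ (1 + 1 / δ) * m ^ δ < D →
      eLpNorm u ∞ μ ≤ ENNReal.ofReal (1 + D) := by
    intro D hD
    have hD0 : 0 < D := lt_of_le_of_lt (by positivity) hD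
    have hzero : μ.real {x | 1 + D < u x} = 0 := by
      refine eq_zero_of_superlevel_decay (φ := fun k => μ.real {x | k < u x}) (k₀ := 1)
        (fun k => measureReal_nonneg) (fun k k' hk => measureReal_mono fun x hx => hk.trans_lt hx)
        hM0 hδ hD0 (fun k d hk hd => ?_) (le_trans ?_ hD.le)
      · have := hu.measureReal_superlevel_le hΩ hA hF (hh.mono_exponent hτt) hp1 hp2 hq1 hS hk hd
        rw [hexp] at this
        rw [hMdef, div_mul_eq_mul_div, le_div_iff₀ hc]
        linarith
      · gcongr
        exact measureReal_mono (Set.subset_univ _)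
    have hae : ∀ᵐ x ∂μ, u x ≤ 1 + D := by
      have := (measureReal_eq_zero_iff).1 hzero
      rw [ae_iff]
      simpa using this
    obtain ⟨Du, -, hu0, -⟩ := hu
    rw [eLpNorm_exponent_top]
    refine eLpNormEssSup_le_of_ae_bound ?_
    filter_upwards [hae, hu0] with x hx hx0
    rwa [Real.norm_eq_abs, abs_of_nonneg hx0]
  refine ⟨⟨hu.choose_spec.1.memLp.1, (hbound _ (lt_add_one _)).trans_lt ENNReal.ofReal_lt_top⟩, ?_⟩
  have hle : (eLpNorm u ∞ μ).toReal ≤ 1 + M * 2 ^ (1 + 1 / δ) * m ^ δ := by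
    refine le_of_forall_pos_le_add fun η hη => ?_
    have h3 := ENNReal.toReal_mono ENNReal.ofReal_ne_top (hbound _ (lt_add_of_pos_right _ hη))
    rwa [ENNReal.toReal_ofReal (by positivity), ← add_assoc] at h3
  refine hle.trans ?_
  push_cast
  rw [hmΩ, Real.coe_toNNReal _ hc.le]
  gcongr 1 + ?_
  calc M * 2 ^ (1 + 1 / δ) * m ^ δ
      ≤ (S ^ 2 * (2 / α) * ((eLpNorm h t μ).toReal * m ^ ε) / c) * 2 ^ (1 + 1 / δ) * m ^ δ := by
        rw [hMdef]
        gcongr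
    _ = _ := by ring

theorem proposition4p3 :
    ∃ C : ℝ≥0 → ℕ → ℝ≥0∞ → ℝ≥0,
      (∀ (N : ℕ) (t : ℝ≥0∞), Monotone fun m => C m N t) ∧
      ∀ (N : ℕ) (t : ℝ≥0∞), 1 ≤ N → (N = 1 → t = 1) → (2 ≤ N → (N : ℝ≥0∞) / 2 < t) →
      ∀ (Ω : Opens (RN N)), Bornology.IsBounded (Ω : Set (RN N)) →
      ∀ (A : RN N → Matrix (Fin N) (Fin N) ℝ) (α : ℝ), CoerciveMatrix Ω A α →
      ∀ (F : RN N → ℝ≥0 → ℝ≥0∞) (γ : ℝ) (h : RN N → ℝ),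
        IsCaratheodory Ω F → GrowthCondition Ω F γ h →
        MemLp h t (volume.restrict Ω) →
      ∀ u : RN N → ℝ, IsSolution Ω A F u →
        MemLp u ∞ (volume.restrict Ω) ∧
        (eLpNorm u ∞ (volume.restrict Ω)).toReal ≤
          1 + 2 / α * C (volume (Ω : Set (RN N))).toNNReal N t *
            (eLpNorm h t (volume.restrict Ω)).toReal := by
  classical
  -- A constant is chosen for each admissible pair (N, t); the value 0 elsewhere keeps C total and
  -- monotone in m.
  refine ⟨fun m N t => if hc : 1 ≤ N ∧ (N = 1 → t = 1) ∧ (2 ≤ N → (N : ℝ≥0∞) / 2 < t) then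
    (exists_bound_const hc.1 hc.2.1 hc.2.2).choose m else 0, fun N t => ?_, ?_⟩
  · by_cases hc : 1 ≤ N ∧ (N = 1 → t = 1) ∧ (2 ≤ N → (N : ℝ≥0∞) / 2 < t)
    · simpa only [dif_pos hc] using (exists_bound_const hc.1 hc.2.1 hc.2.2).choose_spec.1
    · simpa only [dif_neg hc] using monotone_const
  · intro N t hN h1 h2 Ω hΩ A α hA F γ h _ hF hh u hu
    have hc : 1 ≤ N ∧ (N = 1 → t = 1) ∧ (2 ≤ N → (N : ℝ≥0∞) / 2 < t) := ⟨hN, h1, h2⟩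
    simpa only [dif_pos hc] using
      (exists_bound_const hN h1 h2).choose_spec.2 Ω hΩ A α hA F γ h hF hh u hu
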